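/- Let $k$ be an algebraically closed field of characteristic zero and let $n\ge 1$ be an integer. Equip the polynomial algebra $k[x_0,x_1,\dots,x_n]$ with the $\mathbb{Z}^n$-grading whose piece of degree $m=(m_1,\dots,m_n)$ is $k[x_0]\,x_1^{m_1}\cdots x_n^{m_n}$ if $m\in\mathbb{N}^n$, and $0$ otherwise. Let $I$ be an ideal of $k[x_0,\dots,x_n]$ that is homogeneous for this grading (i.e. generated by homogeneous elements). Then the following are equivalent: (i) $I$ is normal, i.e. $I^e$ is integrally closed for every integer $e\ge 1$; (ii) $I^e$ is integrally closed for every $e\in\{1,\dots,n\}$. Here an ideal $J$ of a commutative ring $A$ is called integrally closed if it contains every $a\in A$ satisfying an equation $a^r+c_1a^{r-1}+\dots+c_r=0$ with $r\ge 1$ and $c_i\in J^i$ for $i=1,\dots,r$. -/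

import Mathlib

/-- The element `a` is integral over the ideal `I`: it satisfies an equation
`a ^ r + c₁ a ^ (r - 1) + ⋯ + c_r = 0` with `r ≥ 1` and `c_i ∈ I ^ i` for `1 ≤ i ≤ r`. -/
def IsIntegralOverIdeal {A : Type*} [CommRing A] (I : Ideal A) (a : A) : Prop :=
  ∃ r : ℕ, 1 ≤ r ∧ ∃ c : ℕ → A, (∀ i ∈ Finset.Icc 1 r, c i ∈ I ^ i) ∧
    a ^ r + ∑ i ∈ Finset.Icc 1 r, c i * a ^ (r - i) = 0

/-- The ideal `I` is integrally closed: every element integral over `I` belongs to `I`. -/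
def IsIntegrallyClosedIdeal {A : Type*} [CommRing A] (I : Ideal A) : Prop :=
  ∀ a : A, IsIntegralOverIdeal I a → a ∈ I

/-- The ideal `I` is normal: all its powers `I ^ e`, `e ≥ 1`, are integrally closed. -/
def IsNormalIdeal {A : Type*} [CommRing A] (I : Ideal A) : Prop :=
  ∀ e : ℕ, 1 ≤ e → IsIntegrallyClosedIdeal (I ^ e)

/-- The degrees of the variables `x₀, x₁, …, x_n` in `ℤⁿ`: `x₀` has degree `0`, and `x_i` has
degree the `i`-th standard basis vector. -/
def varDegree (n : ℕ) : Fin (n + 1) → (Fin n → ℤ) :=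
  Fin.cons 0 fun i => Pi.single i 1

/-- The piece of degree `m ∈ ℤⁿ` of the polynomial algebra `k[x₀, …, x_n]`. It is
`k[x₀] x₁ ^ m₁ ⋯ x_n ^ m_n` if `m ∈ ℕⁿ` (see `mem_gradedPiece_natCast`), and zero otherwise
(see `gradedPiece_eq_bot`). -/
noncomputable def gradedPiece (k : Type*) [Field k] (n : ℕ) (m : Fin n → ℤ) :
    Submodule k (MvPolynomial (Fin (n + 1)) k) :=
  MvPolynomial.weightedHomogeneousSubmodule k (varDegree n) m

/-- The `ℤⁿ`-grading of `k[x₀, …, x_n]`. -/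
noncomputable instance gradedPiece.gradedAlgebra (k : Type*) [Field k] (n : ℕ) :
    GradedAlgebra (gradedPiece k n) :=
  MvPolynomial.weightedGradedAlgebra k (varDegree n)

theorem weight_varDegree (n : ℕ) (d : Fin (n + 1) →₀ ℕ) :
    Finsupp.weight (varDegree n) d = fun i => (d i.succ : ℤ) := by
  funext j
  simp [Finsupp.weight_apply, Finsupp.sum_fintype, Fin.sum_univ_succ, varDegree, Finset.sum_apply,
    Pi.single_apply]

/-- The piece of degree `m ∈ ℕⁿ` is `k[x₀] x₁ ^ m₁ ⋯ x_n ^ m_n`. -/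
theorem mem_gradedPiece_natCast {k : Type*} [Field k] {n : ℕ} (m : Fin n → ℕ)
    (f : MvPolynomial (Fin (n + 1)) k) :
    f ∈ gradedPiece k n (fun i => (m i : ℤ)) ↔
      ∃ p : Polynomial k, f = Polynomial.aeval (MvPolynomial.X 0) p *
        ∏ i : Fin n, MvPolynomial.X i.succ ^ m i := by
  have hmon : ∀ a : ℕ, ∀ b : k, MvPolynomial.monomial (Finsupp.equivFunOnFinite.symm
      (Fin.cons a m : Fin (n + 1) → ℕ)) b = Polynomial.aeval (MvPolynomial.X 0)
        (Polynomial.monomial a b) * ∏ i : Fin n, MvPolynomial.X i.succ ^ m i := by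
    intro a b
    rw [MvPolynomial.monomial_eq, Finsupp.prod_fintype _ _ (by simp), Fin.prod_univ_succ,
      Polynomial.aeval_monomial]
    simp [MvPolynomial.algebraMap_eq, mul_assoc]
  constructor
  · intro hf
    refine ⟨∑ d ∈ f.support, Polynomial.monomial (d 0) (f.coeff d), ?_⟩
    rw [map_sum, Finset.sum_mul]
    conv_lhs => rw [f.as_sum]
    refine Finset.sum_congr rfl fun d hd => ?_
    have h := hf (MvPolynomial.mem_support_iff.mp hd)
    rw [weight_varDegree] at h
    have hd' : d = Finsupp.equivFunOnFinite.symm (Fin.cons (d 0) m : Fin (n + 1) → ℕ) := by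
      ext i
      refine Fin.cases ?_ (fun j => ?_) i
      · simp
      · have := congrFun h j
        simpa using this
    rw [← hmon, ← hd']
  · rintro ⟨p, rfl⟩
    induction p using Polynomial.induction_on' with
    | add p q hp hq => rw [map_add, add_mul]; exact add_mem hp hq
    | monomial a b =>
      rw [← hmon]
      refine MvPolynomial.isWeightedHomogeneous_monomial _ _ _ ?_
      rw [weight_varDegree]
      simp

/-- The pieces of degree `m ∉ ℕⁿ` are zero. -/
theorem gradedPiece_eq_bot {k : Type*} [Field k] {n : ℕ} (m : Fin n → ℤ) {i : Fin n}
    (hi : m i < 0) : gradedPiece k n m = ⊥ := by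
  rw [eq_bot_iff]
  intro f hf
  rw [Submodule.mem_bot, MvPolynomial.eq_zero_iff]
  intro d
  by_contra hd
  have h := hf hd
  rw [weight_varDegree] at h
  have := congrFun h i
  omega

/-! Write `k[x₀, …, x_n] = R[x₁, …, x_n]` with `R = k[x₀]`, a PID; homogeneity makes the image `J`
of `I` contain every term of its elements. Locally at a prime `p` of `R`, `J` is monomial in `p, x₁,
…, x_n`, and integral closedness becomes a saturation property of upper sets in `ℕ × ℕⁿ`. Passing
from `e ≥ n` to `e + 1` is Carathéodory (`isClosedAt_succ`): the `p`-exponent need only not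
increase, so `n + 1` generators suffice instead of `n + 2`. Their weights sum to `e + 1 ≥ n + 1`, so
one weight is at least `1`; splitting off that generator leaves a point of level `e`. Saturation at
all `p` gives back integral closedness by peeling off leading terms
(`isIntegrallyClosedIdeal_pow_of_isClosedAt`). -/

/-! ### Filtrations of exponents and Dickson's lemma. -/

/-- A multiplicative filtration by upper sets of an ordered additive monoid, such as the sets of
exponents of the powers of a monomial ideal. -/
structure ExponentFiltration (M : Type*) [AddCommMonoid M] [PartialOrder M] where
  /-- The `e`-th step of the filtration. -/
  carrier : ℕ → Set M
  upper : ∀ e, IsUpperSet (carrier e)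
  zero_mem : ∀ z, z ∈ carrier 0
  add_mem : ∀ {a b z w}, z ∈ carrier a → w ∈ carrier b → z + w ∈ carrier (a + b)
  exists_add : ∀ {a b z}, z ∈ carrier (a + b) → ∃ x ∈ carrier a, ∃ y ∈ carrier b, x + y ≤ z

namespace ExponentFiltration

/-- The step `T e` of the filtration contains every `w` such that `r • w ∈ T (e * r)` for some
`r ≥ 1`. -/
def IsClosedAt {M : Type*} [AddCommMonoid M] [PartialOrder M] (T : ExponentFiltration M)
    (e : ℕ) : Prop :=
  ∀ (w : M) (r : ℕ), 1 ≤ r → r • w ∈ T.carrier (e * r) → w ∈ T.carrier e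

theorem nsmul_mem {M : Type*} [AddCommMonoid M] [PartialOrder M] (T : ExponentFiltration M)
    {z : M} (hz : z ∈ T.carrier 1) (k : ℕ) : k • z ∈ T.carrier k := by
  induction k with
  | zero => exact T.zero_mem _
  | succ k ih => rw [succ_nsmul]; exact T.add_mem ih hz

theorem sum_nsmul_mem {M : Type*} [AddCommMonoid M] [PartialOrder M] (T : ExponentFiltration M)
    {ι : Type*} (s : Finset ι) (c : ι → ℕ) (α : ι → M) (hα : ∀ i ∈ s, α i ∈ T.carrier 1) :
    ∑ i ∈ s, c i • α i ∈ T.carrier (∑ i ∈ s, c i) := by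
  classical
  induction s using Finset.induction_on with
  | empty => simpa using T.zero_mem _
  | insert a s ha ih =>
    rw [Finset.sum_insert ha, Finset.sum_insert ha]
    exact T.add_mem (T.nsmul_mem (hα a (by simp)) _) (ih fun i hi => hα i (by simp [hi]))

/-- Minimal elements of step `1` form an antichain, hence a finite set; `exists_add` splits an
element of step `t` into `t` elements of step `1`. -/
theorem exists_finite_generators {M : Type*} [AddCommMonoid M] [PartialOrder M]
    [IsOrderedAddMonoid M] [WellQuasiOrderedLE M] (hM : ∀ z : M, 0 ≤ z)
    (T : ExponentFiltration M) :
    ∃ G : Finset M, (∀ g ∈ G, g ∈ T.carrier 1) ∧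
      ∀ t z, z ∈ T.carrier t → ∃ c : M → ℕ, ∑ g ∈ G, c g = t ∧ ∑ g ∈ G, c g • g ≤ z := by
  classical
  have hfin : {z | Minimal (· ∈ T.carrier 1) z}.Finite :=
    WellQuasiOrderedLE.finite_of_isAntichain (setOfPred_minimal_antichain _)
  refine ⟨hfin.toFinset, fun g hg => ?_, fun t => ?_⟩
  · exact ((Set.Finite.mem_toFinset hfin).1 hg).prop
  · induction t with
    | zero => exact fun z _ => ⟨0, by simp, by simpa using hM z⟩
    | succ t ih =>
      intro z hz
      obtain ⟨x, hx, y, hy, hxy⟩ := T.exists_add hz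
      obtain ⟨c, hc, hcx⟩ := ih x hx
      obtain ⟨g, hgy, hg⟩ := exists_minimal_le_of_wellFoundedLT (· ∈ T.carrier 1) y hy
      have hgG : g ∈ hfin.toFinset := (Set.Finite.mem_toFinset hfin).2 hg
      refine ⟨c + Pi.single g 1, ?_, ?_⟩
      · simp only [Pi.add_apply, Finset.sum_add_distrib, hc]
        rw [Finset.sum_eq_single g (fun b _ hb => Pi.single_eq_of_ne hb _)
          (fun h => absurd hgG h), Pi.single_eq_same]
      · simp only [Pi.add_apply, add_nsmul, Finset.sum_add_distrib]
        have : ∑ h ∈ hfin.toFinset, (Pi.single g 1 : M → ℕ) h • h = g := by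
          rw [Finset.sum_eq_single g]
          · simp
          · intro b _ hb; simp [Pi.single_eq_of_ne hb]
          · intro h; exact absurd hgG h
        rw [this]
        exact (add_le_add hcx hgy).trans hxy

/-- Write `v + s • w` as generators with multiplicities `c s` plus a remainder `d s`.
Well-quasi-ordering gives `s < s + r` at which both grow; subtracting cancels `v` and exhibits `r •
w` above a sum of `e * r` generators. -/
theorem exists_nsmul_mem_of_forall_add_nsmul_mem {σ : Type*} [Finite σ]
    (T : ExponentFiltration (ℕ × (σ →₀ ℕ))) {v w : ℕ × (σ →₀ ℕ)} {e : ℕ}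
    (h : ∀ s : ℕ, v + s • w ∈ T.carrier (e * s)) :
    ∃ r : ℕ, 1 ≤ r ∧ r • w ∈ T.carrier (e * r) := by
  classical
  obtain ⟨G, hG, hgen⟩ := T.exists_finite_generators (fun z => zero_le)
  choose c hc hcs using fun s => hgen _ _ (h s)
  choose d hd using fun s => exists_add_of_le (hcs s)
  obtain ⟨s, t, hst, hle⟩ := wellQuasiOrdered_le (α := (G → ℕ) × (ℕ × (σ →₀ ℕ)))
    (fun s => (fun g => c s g, d s))
  obtain ⟨hle1, hle2⟩ := hle
  obtain ⟨b, hb⟩ := exists_add_of_le hle2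
  obtain ⟨r, rfl⟩ := exists_add_of_le hst.le
  have hcle : ∀ g ∈ G, c (s + r) g = c s g + (c (s + r) g - c s g) := fun g hg => by
    have := hle1 ⟨g, hg⟩
    simp only at this
    omega
  have hsum : ∑ g ∈ G, (c (s + r) g - c s g) = e * r := by
    have h1 := hc (s + r)
    rw [Finset.sum_congr rfl hcle, Finset.sum_add_distrib, hc s, mul_add] at h1
    omega
  refine ⟨r, by omega, ?_⟩
  have hmem := T.sum_nsmul_mem G (fun g => c (s + r) g - c s g) id hG
  rw [hsum] at hmem
  refine T.upper _ ?_ hmem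
  refine le_iff_exists_add.2 ⟨b, ?_⟩
  have h1 := hd (s + r)
  simp only at hb
  rw [hb, Finset.sum_congr rfl fun g hg => by rw [hcle g hg, add_nsmul], Finset.sum_add_distrib,
    add_nsmul, ← add_assoc, hd s] at h1
  simp only [id]
  have h2 : (∑ g ∈ G, c s g • g + d s) + r • w =
      (∑ g ∈ G, c s g • g + d s) + (∑ g ∈ G, (c (s + r) g - c s g) • g + b) := by
    rw [h1]; abel
  exact add_left_cancel h2

end ExponentFiltration

/-! ### Rational weights and Carathéodory's theorem. -/

/-- Carathéodory reduction that fixes the weighted sum of the `m i` and does not increase the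
weighted sum of the heights `h i`. -/
theorem exists_weights_card_support_le {σ ι : Type*} [Fintype σ] [DecidableEq ι] (s : Finset ι)
    (m : ι → σ → ℚ) (h : ι → ℚ) (l : ι → ℚ) (hl : ∀ i ∈ s, 0 ≤ l i) :
    ∃ t ⊆ s, ∃ l' : ι → ℚ, (∀ i ∈ t, 0 ≤ l' i) ∧ ∑ i ∈ t, l' i = ∑ i ∈ s, l i ∧
      (∀ j, ∑ i ∈ t, l' i * m i j = ∑ i ∈ s, l i * m i j) ∧
      ∑ i ∈ t, l' i * h i ≤ ∑ i ∈ s, l i * h i ∧ t.card ≤ Fintype.card σ + 1 := by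
  induction hn : s.card using Nat.strong_induction_on generalizing s l with
  | _ N ih =>
  by_cases hcard : s.card ≤ Fintype.card σ + 1
  · exact ⟨s, subset_rfl, l, hl, rfl, fun _ => rfl, le_rfl, hcard⟩
  -- The coordinate `none` is constantly `1`, so a linear relation here is an affine dependence
  -- among the `m i`.
  have hdep : ¬ LinearIndependent ℚ
      (fun i : s => (fun o => o.elim 1 (m i) : Option σ → ℚ)) := fun hli => by
    have := hli.fintype_card_le_finrank
    simp at this
    omega
  obtain ⟨g, hg, i₀, hi₀⟩ := Fintype.not_linearIndependent_iff.1 hdep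
  obtain ⟨μ, hμ1, hμm, hμh, hμ0⟩ : ∃ μ : ι → ℚ, ∑ i ∈ s, μ i = 0 ∧
      (∀ j, ∑ i ∈ s, μ i * m i j = 0) ∧ 0 ≤ ∑ i ∈ s, μ i * h i ∧ ∃ i ∈ s, μ i ≠ 0 := by
    let μ : ι → ℚ := fun i => if hi : i ∈ s then g ⟨i, hi⟩ else 0
    have hconv : ∀ f : ι → ℚ, ∑ i ∈ s, μ i * f i = ∑ i : s, g i * f i := fun f => by
      rw [← Finset.sum_coe_sort s]
      exact Finset.sum_congr rfl fun i _ => by simp [μ]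
    have h1 : ∑ i ∈ s, μ i = 0 := by
      have h2 := hconv 1
      have h3 := congrFun hg none
      simp only [Finset.sum_apply, Pi.smul_apply, smul_eq_mul, Option.elim, Pi.zero_apply] at h3
      simp only [Pi.one_apply, mul_one] at h2 h3
      exact h2.trans h3
    have hm : ∀ j, ∑ i ∈ s, μ i * m i j = 0 := fun j => by
      have h3 := congrFun hg (some j)
      simp only [Finset.sum_apply, Pi.smul_apply, smul_eq_mul, Option.elim, Pi.zero_apply] at h3
      rw [hconv fun i => m i j, h3]
    have hne : ∃ i ∈ s, μ i ≠ 0 := ⟨i₀, i₀.2, by simpa [μ] using hi₀⟩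
    -- The sign of the relation is chosen so that subtracting a nonnegative multiple of it cannot
    -- raise the height.
    rcases le_total 0 (∑ i ∈ s, μ i * h i) with hs | hs
    · exact ⟨μ, h1, hm, hs, hne⟩
    · exact ⟨-μ, by simp [h1], by simp [hm], by simpa using hs, by simpa using hne⟩
  have hpos : (s.filter fun i => 0 < μ i).Nonempty := by
    obtain ⟨i, hi, hi'⟩ := Finset.exists_pos_of_sum_zero_of_exists_nonzero μ hμ1 hμ0
    exact ⟨i, by simp [hi, hi']⟩
  -- The least ratio is the largest multiple of `μ` that keeps all weights nonnegative; it kills the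
  -- weight at `i₁`.
  obtain ⟨i₁, hi₁, hmin⟩ := Finset.exists_min_image _ (fun i => l i / μ i) hpos
  rw [Finset.mem_filter] at hi₁
  set τ := l i₁ / μ i₁ with hτ
  have hτ0 : 0 ≤ τ := div_nonneg (hl _ hi₁.1) hi₁.2.le
  let l₁ : ι → ℚ := fun i => l i - τ * μ i
  have hl₁0 : l₁ i₁ = 0 := by
    have := hi₁.2.ne'
    simp only [l₁, hτ]
    field_simp
    ring
  have hl₁ : ∀ i ∈ s, 0 ≤ l₁ i := fun i hi => by
    simp only [l₁]
    rcases le_or_gt (μ i) 0 with hneg | hp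
    · nlinarith [hl i hi, mul_nonneg hτ0 (neg_nonneg.2 hneg)]
    · have := hmin i (by simp [hi, hp])
      rw [le_div_iff₀ hp] at this
      linarith
  have hsum : ∀ f : ι → ℚ, ∑ i ∈ s.erase i₁, l₁ i * f i =
      ∑ i ∈ s, l i * f i - τ * ∑ i ∈ s, μ i * f i := fun f => by
    have := Finset.sum_erase_add s (fun i => l₁ i * f i) hi₁.1
    rw [hl₁0, zero_mul, add_zero] at this
    rw [this, Finset.mul_sum, ← Finset.sum_sub_distrib]
    exact Finset.sum_congr rfl fun i _ => by simp only [l₁]; ring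
  obtain ⟨t, hts, l', h0, h1, h2, h3, h4⟩ := ih _ (hn ▸ Finset.card_erase_lt_of_mem hi₁.1)
    (s.erase i₁) l₁ (fun i hi => hl₁ i (Finset.mem_of_mem_erase hi)) rfl
  refine ⟨t, hts.trans (Finset.erase_subset _ _), l', h0, ?_, fun j => ?_, h3.trans ?_, h4⟩
  · have := hsum 1
    simp only [Pi.one_apply, mul_one, hμ1, mul_zero, sub_zero] at this
    rw [h1, this]
  · rw [h2, hsum fun i => m i j, hμm, mul_zero, sub_zero]
  · rw [hsum]
    exact sub_le_self _ (mul_nonneg hτ0 hμh)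

/-- Clearing denominators of nonnegative rational weights. -/
theorem exists_common_denominator {ι : Type*} (t : Finset ι) (l : ι → ℚ) (hl : ∀ i ∈ t, 0 ≤ l i) :
    ∃ r : ℕ, 1 ≤ r ∧ ∃ c : ι → ℕ, ∀ i ∈ t, (c i : ℚ) = r * l i := by
  refine ⟨∏ i ∈ t, (l i).den, Nat.one_le_iff_ne_zero.2 (Finset.prod_ne_zero_iff.2 fun i _ =>
    (l i).den_nz), fun i => ((∏ i ∈ t, (l i).den) / (l i).den) * (l i).num.toNat, fun i hi => ?_⟩
  obtain ⟨q, hq⟩ := Finset.dvd_prod_of_mem (fun i => (l i).den) hi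
  have hd : ((l i).den : ℚ) ≠ 0 := by exact_mod_cast (l i).den_nz
  have hnum : (((l i).num.toNat : ℕ) : ℚ) = l i * (l i).den := by
    rw [Rat.mul_den_eq_num]
    have : (((l i).num.toNat : ℕ) : ℤ) = (l i).num :=
      Int.toNat_of_nonneg (Rat.num_nonneg.2 (hl i hi))
    exact_mod_cast this
  beta_reduce
  rw [hq, Nat.mul_div_cancel_left _ (l i).den_pos]
  push_cast
  rw [hnum]
  ring

/-! ### Saturation passes from level `e` to level `e + 1`. -/

namespace ExponentFiltration

theorem isClosedAt_succ {σ : Type*} [Fintype σ] (T : ExponentFiltration (ℕ × (σ →₀ ℕ))) {e : ℕ}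
    (he : Fintype.card σ ≤ e) (hT : T.IsClosedAt e) : T.IsClosedAt (e + 1) := by
  classical
  intro w r hr hw
  obtain ⟨G, hG, hgen⟩ := T.exists_finite_generators (fun z => zero_le)
  obtain ⟨c, hc, hcw⟩ := hgen _ _ hw
  have hr0 : (0 : ℚ) < r := by exact_mod_cast hr
  obtain ⟨t, htG, l, hl0, hl1, hlm, hlh, hcard⟩ := exists_weights_card_support_le G
    (fun g j => (g.2 j : ℚ)) (fun g => (g.1 : ℚ)) (fun g => (c g : ℚ) / r)
    (fun g _ => by positivity)
  have hsum : ∑ g ∈ t, l g = e + 1 := by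
    rw [hl1, ← Finset.sum_div, ← Nat.cast_sum, hc]
    push_cast
    field_simp
  have hscale : ∀ b : ℕ, ∀ f : ℕ × (σ →₀ ℕ) → ℕ, ∑ g ∈ G, c g * f g ≤ r * b →
      ∑ g ∈ G, (c g : ℚ) / r * f g ≤ b := fun b f h => by
    have : (∑ g ∈ G, (c g : ℚ) * f g) ≤ r * b := by exact_mod_cast h
    calc ∑ g ∈ G, (c g : ℚ) / r * f g = (∑ g ∈ G, (c g : ℚ) * f g) / r := by
          rw [Finset.sum_div]; exact Finset.sum_congr rfl fun _ _ => by ring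
      _ ≤ b := by rw [div_le_iff₀ hr0]; linarith
  have hh : ∑ g ∈ t, l g * g.1 ≤ w.1 := hlh.trans <| hscale _ (fun g => g.1) <| by
    simpa [Prod.fst_sum] using hcw.1
  have hm : ∀ j, ∑ g ∈ t, l g * g.2 j ≤ w.2 j := fun j => (hlm j).trans_le <|
    hscale _ (fun g => g.2 j) <| by
      simpa [Prod.snd_sum, Finsupp.finsetSum_apply] using hcw.2 j
  -- If all weights were below `1`, their sum `e + 1` would be less than `t.card ≤ Fintype.card σ +
  -- 1 ≤ e + 1`.
  obtain ⟨a, ha, hla⟩ : ∃ a ∈ t, 1 ≤ l a := by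
    by_contra! hlt
    have hne : t.Nonempty := by
      rw [Finset.nonempty_iff_ne_empty]
      rintro rfl
      have : (0 : ℚ) ≤ e := Nat.cast_nonneg e
      rw [Finset.sum_empty] at hsum
      linarith
    have h1 := Finset.sum_lt_sum_of_nonempty hne hlt
    rw [hsum, Finset.sum_const, nsmul_eq_mul, mul_one] at h1
    have : e + 1 < t.card := by exact_mod_cast h1
    omega
  have hterm : ∀ f : ℕ × (σ →₀ ℕ) → ℕ, ∀ b : ℕ, ∑ g ∈ t, l g * f g ≤ b → f a ≤ b := fun f b h => by
    have h1 : l a * f a ≤ ∑ g ∈ t, l g * f g :=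
      Finset.single_le_sum (f := fun g => l g * (f g : ℚ))
        (fun g hg => mul_nonneg (hl0 g hg) (Nat.cast_nonneg _)) ha
    have h2 : (f a : ℚ) ≤ l a * f a := le_mul_of_one_le_left (Nat.cast_nonneg _) hla
    exact_mod_cast h2.trans (h1.trans h)
  have haw : a ≤ w := ⟨hterm (fun g => g.1) _ hh, fun j => hterm (fun g => g.2 j) _ (hm j)⟩
  obtain ⟨w', rfl⟩ := exists_add_of_le haw
  -- One copy of `a` is removed: the remaining weights sum to `e` and certify `w'` after clearing
  -- denominators.
  let l' : ℕ × (σ →₀ ℕ) → ℚ := fun g => l g - if g = a then 1 else 0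
  have hl'sum : ∀ f : ℕ × (σ →₀ ℕ) → ℚ, ∑ g ∈ t, l' g * f g = ∑ g ∈ t, l g * f g - f a :=
    fun f => by simp [l', sub_mul, Finset.sum_sub_distrib, ha]
  have hl'0 : ∀ g ∈ t, 0 ≤ l' g := fun g hg => by
    simp only [l']
    split_ifs with h
    · rw [h]; linarith
    · simpa using hl0 g hg
  obtain ⟨q, hq, d, hd⟩ := exists_common_denominator t l' hl'0
  have hdsum : ∀ f : ℕ × (σ →₀ ℕ) → ℕ, ∀ b : ℕ, ∑ g ∈ t, l g * f g ≤ (f a + b : ℕ) →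
      ∑ g ∈ t, d g * f g ≤ q * b := fun f b h => by
    have h1 : (∑ g ∈ t, (d g : ℚ) * f g) = q * (∑ g ∈ t, l g * f g - f a) := by
      rw [← hl'sum fun g => (f g : ℚ), Finset.mul_sum]
      exact Finset.sum_congr rfl fun g hg => by rw [hd g hg]; ring
    have h2 : (∑ g ∈ t, (d g : ℚ) * f g) ≤ q * b := by
      rw [h1]
      push_cast at h
      exact mul_le_mul_of_nonneg_left (by linarith) (Nat.cast_nonneg _)
    exact_mod_cast h2
  have hdtot : ∑ g ∈ t, d g = e * q := by
    have h1 : (∑ g ∈ t, (d g : ℚ)) = e * q := by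
      rw [Finset.sum_congr rfl hd, ← Finset.mul_sum]
      have := hl'sum 1
      simp only [Pi.one_apply, mul_one, hsum] at this
      rw [this]
      ring
    exact_mod_cast h1
  have hmem := T.sum_nsmul_mem t d id fun g hg => hG g (htG hg)
  rw [hdtot] at hmem
  have hw' : w' ∈ T.carrier e := by
    refine hT w' q hq (T.upper _ ?_ hmem)
    refine ⟨?_, fun j => ?_⟩
    · simpa [Prod.fst_sum] using hdsum (fun g => g.1) w'.1 (by simpa using hh)
    · simpa [Prod.snd_sum, Finsupp.finsetSum_apply] using
        hdsum (fun g => g.2 j) (w'.2 j) (by simpa using hm j)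
  rw [add_comm a]
  exact T.add_mem hw' (hG a (htG ha))

theorem isClosedAt_of_forall_le_card {σ : Type*} [Fintype σ]
    (T : ExponentFiltration (ℕ × (σ →₀ ℕ)))
    (hT : ∀ e, 1 ≤ e → e ≤ Fintype.card σ → T.IsClosedAt e) (e : ℕ) (he : 1 ≤ e) :
    T.IsClosedAt e := by
  rcases le_total e (Fintype.card σ) with h | h
  · exact hT e he h
  · induction e, h using Nat.le_induction with
    | base => exact hT _ he le_rfl
    | succ e h ih =>
      refine T.isClosedAt_succ h ?_
      -- Level `0` arises only for empty `σ`, and is saturated because step `0` is everything.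
      rcases Nat.eq_zero_or_pos e with rfl | hpos
      · exact fun w _ _ _ => T.zero_mem w
      · exact ih hpos

end ExponentFiltration

/-! ### Multihomogeneous ideals and their local exponents. -/

open MvPolynomial in
/-- An ideal of a polynomial ring that contains all the terms of its elements. -/
def IsMultihomogeneous {σ R : Type*} [CommRing R] (J : Ideal (MvPolynomial σ R)) : Prop :=
  ∀ f ∈ J, ∀ m, monomial m (coeff m f) ∈ J

namespace IsMultihomogeneous

open MvPolynomial

theorem top {σ R : Type*} [CommRing R] :
    IsMultihomogeneous (⊤ : Ideal (MvPolynomial σ R)) := fun _ _ _ => trivial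

theorem mul {σ R : Type*} [CommRing R] {J K : Ideal (MvPolynomial σ R)}
    (hJ : IsMultihomogeneous J) (hK : IsMultihomogeneous K) : IsMultihomogeneous (J * K) := by
  classical
  intro f hf m
  induction hf using Submodule.mul_induction_on' with
  | mem_mul_mem f hf g hg =>
    rw [coeff_mul, map_sum]
    refine Ideal.sum_mem _ fun x hx => ?_
    rw [← Finset.HasAntidiagonal.mem_antidiagonal.1 hx, ← monomial_mul]
    exact Ideal.mul_mem_mul (hJ f hf _) (hK g hg _)
  | add f _ g _ ihf ihg => rw [coeff_add, map_add]; exact add_mem ihf ihg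

theorem pow {σ R : Type*} [CommRing R] {J : Ideal (MvPolynomial σ R)}
    (hJ : IsMultihomogeneous J) (e : ℕ) : IsMultihomogeneous (J ^ e) := by
  induction e with
  | zero => simpa using top
  | succ e ih => rw [pow_succ]; exact ih.mul hJ

end IsMultihomogeneous

open MvPolynomial in
/-- The exponents `(i, m)` such that `p ^ i * x ^ m` belongs to `J` locally at `p`. -/
def localExponents {σ R : Type*} [CommRing R] (p : R) (J : Ideal (MvPolynomial σ R)) :
    Set (ℕ × (σ →₀ ℕ)) :=
  {z | ∃ u, ¬ p ∣ u ∧ monomial z.2 (u * p ^ z.1) ∈ J}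

section LocalExponents

open MvPolynomial

theorem isUpperSet_localExponents {σ R : Type*} [CommRing R] (p : R)
    (J : Ideal (MvPolynomial σ R)) : IsUpperSet (localExponents p J) := by
  rintro z w hzw ⟨u, hu, hz⟩
  obtain ⟨d, rfl⟩ := exists_add_of_le hzw
  refine ⟨u, hu, ?_⟩
  have := J.mul_mem_right (monomial d.2 (p ^ d.1)) hz
  rwa [monomial_mul, mul_assoc, ← pow_add] at this

theorem add_mem_localExponents {σ R : Type*} [CommRing R] {p : R} (hp : Prime p)
    {J K : Ideal (MvPolynomial σ R)} {z w : ℕ × (σ →₀ ℕ)} (hz : z ∈ localExponents p J)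
    (hw : w ∈ localExponents p K) : z + w ∈ localExponents p (J * K) := by
  obtain ⟨u, hu, hz⟩ := hz
  obtain ⟨v, hv, hw⟩ := hw
  refine ⟨u * v, fun h => (hp.dvd_or_dvd h).elim hu hv, ?_⟩
  have := Ideal.mul_mem_mul hz hw
  rw [monomial_mul] at this
  convert this using 1
  refine congrArg (monomial _) ?_
  rw [Prod.fst_add, pow_add]
  ring

theorem exists_eq_mul_pow_of_ne_zero {R : Type*} [CommRing R] [IsDomain R] [IsPrincipalIdealRing R]
    {p : R} (hp : Prime p) {a : R} (ha : a ≠ 0) : ∃ u i, ¬ p ∣ u ∧ a = u * p ^ i := by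
  obtain ⟨c, hc, hpc⟩ := (FiniteMultiplicity.of_prime_left hp ha).exists_eq_pow_mul_and_not_dvd
  exact ⟨c, _, hpc, hc.trans (mul_comm _ _)⟩

theorem not_pow_succ_dvd_mul_pow {R : Type*} [CommRing R] [IsDomain R] {p u : R} (hp : Prime p)
    (hu : ¬ p ∣ u) (i : ℕ) : ¬ p ^ (i + 1) ∣ u * p ^ i := by
  rw [pow_succ', mul_dvd_mul_iff_right (pow_ne_zero _ hp.ne_zero)]
  exact hu

theorem exists_add_le_of_mem_localExponents_mul {σ R : Type*} [CommRing R] [IsDomain R]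
    [IsPrincipalIdealRing R] {p : R} (hp : Prime p) {J K : Ideal (MvPolynomial σ R)}
    (hJ : IsMultihomogeneous J) (hK : IsMultihomogeneous K) {z : ℕ × (σ →₀ ℕ)}
    (hz : z ∈ localExponents p (J * K)) :
    ∃ x ∈ localExponents p J, ∃ y ∈ localExponents p K, x + y ≤ z := by
  classical
  obtain ⟨u, hu, hz⟩ := hz
  -- Non-divisibility of a coefficient by `p ^ (i + 1)` is inherited by some summand, which makes
  -- the claim provable by induction on sums of products.
  suffices h : ∀ f ∈ J * K, ∀ m i, ¬ p ^ (i + 1) ∣ coeff m f →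
      ∃ x ∈ localExponents p J, ∃ y ∈ localExponents p K, x + y ≤ (i, m) by
    refine h _ hz z.2 z.1 ?_
    rw [coeff_monomial, if_pos rfl]
    exact not_pow_succ_dvd_mul_pow hp hu _
  intro f hf m i hi
  induction hf using Submodule.mul_induction_on' with
  | mem_mul_mem f hf g hg =>
    rw [coeff_mul] at hi
    obtain ⟨⟨m₁, m₂⟩, hm, hi⟩ : ∃ x ∈ Finset.HasAntidiagonal.antidiagonal m,
        ¬ p ^ (i + 1) ∣ coeff x.1 f * coeff x.2 g := by
      by_contra! h
      exact hi (Finset.dvd_sum h)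
    rw [Finset.HasAntidiagonal.mem_antidiagonal] at hm
    have hne : coeff m₁ f * coeff m₂ g ≠ 0 := fun h => hi (h ▸ dvd_zero _)
    obtain ⟨u₁, i₁, hu₁, h₁⟩ := exists_eq_mul_pow_of_ne_zero hp (left_ne_zero_of_mul hne)
    obtain ⟨u₂, i₂, hu₂, h₂⟩ := exists_eq_mul_pow_of_ne_zero hp (right_ne_zero_of_mul hne)
    refine ⟨(i₁, m₁), ⟨u₁, hu₁, h₁ ▸ hJ f hf m₁⟩, (i₂, m₂), ⟨u₂, hu₂, h₂ ▸ hK g hg m₂⟩, ?_, hm.le⟩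
    by_contra hlt
    refine hi ?_
    rw [h₁, h₂, mul_mul_mul_comm, ← pow_add]
    exact (pow_dvd_pow p (by simpa using hlt)).mul_left _
  | add f _ g _ ihf ihg =>
    rw [coeff_add] at hi
    by_cases h : p ^ (i + 1) ∣ coeff m f
    · exact ihg fun h' => hi (dvd_add h h')
    · exact ihf h

/-- The local exponents at `p` of the powers of an ideal. -/
def exponentFiltration {σ R : Type*} [CommRing R] [IsDomain R] [IsPrincipalIdealRing R] {p : R}
    (hp : Prime p) {J : Ideal (MvPolynomial σ R)} (hJ : IsMultihomogeneous J) :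
    ExponentFiltration (ℕ × (σ →₀ ℕ)) where
  carrier e := localExponents p (J ^ e)
  upper _ := isUpperSet_localExponents _ _
  zero_mem _ := ⟨1, fun h => hp.not_isUnit (isUnit_of_dvd_one h), by simp⟩
  add_mem hz hw := by rw [pow_add]; exact add_mem_localExponents hp hz hw
  exists_add hz := by
    rw [pow_add] at hz
    exact exists_add_le_of_mem_localExponents_mul hp (hJ.pow _) (hJ.pow _) hz

/-! ### Integral closedness versus saturation at all primes. -/

theorem isIntegralOverIdeal_of_pow_mem {A : Type*} [CommRing A] {I : Ideal A} {a : A} {r : ℕ}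
    (hr : 1 ≤ r) (h : a ^ r ∈ I ^ r) : IsIntegralOverIdeal I a := by
  refine ⟨r, hr, Pi.single r (-a ^ r), fun i _ => ?_, ?_⟩
  · rcases eq_or_ne i r with rfl | hi
    · rw [Pi.single_eq_same]; exact neg_mem h
    · rw [Pi.single_eq_of_ne hi]; exact zero_mem _
  · rw [Finset.sum_eq_single r]
    · simp
    · intro b _ hb; rw [Pi.single_eq_of_ne hb, zero_mul]
    · intro h; simp [hr] at h

theorem isClosedAt_exponentFiltration {σ R : Type*} [CommRing R] [IsDomain R]
    [IsPrincipalIdealRing R] {p : R} (hp : Prime p) {J : Ideal (MvPolynomial σ R)}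
    (hJ : IsMultihomogeneous J) {e : ℕ} (h : IsIntegrallyClosedIdeal (J ^ e)) :
    (exponentFiltration hp hJ).IsClosedAt e := by
  rintro ⟨i, m⟩ r hr ⟨u, hu, hmem⟩
  refine ⟨u, hu, h _ (isIntegralOverIdeal_of_pow_mem hr ?_)⟩
  obtain ⟨r, rfl⟩ := exists_add_of_le hr
  rw [← pow_mul, monomial_pow]
  -- The factor `u ^ r` completes `u` to `u ^ (1 + r)`, making the term an exact power.
  have := (J ^ (e * (1 + r))).mul_mem_left (C (u ^ r)) hmem
  rw [C_mul_monomial] at this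
  convert this using 1
  refine congrArg (monomial _) ?_
  simp only [Prod.smul_fst, smul_eq_mul]
  ring

/-- For nonzero `b ∈ J`, the element `b ^ (r - 1)` lies in `J ^ s` for all `s < r`; the integral
equation handles larger `s` recursively. -/
theorem IsIntegralOverIdeal.exists_mul_pow_mem {A : Type*} [CommRing A] [IsDomain A] {J : Ideal A}
    {f : A} (hf : IsIntegralOverIdeal J f) (hf0 : f ≠ 0) :
    ∃ c ≠ 0, ∀ s, c * f ^ s ∈ J ^ s := by
  obtain ⟨r, hr, c, hc, heq⟩ := hf
  have hJ : J ≠ ⊥ := by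
    rintro rfl
    rw [Finset.sum_eq_zero, add_zero] at heq
    · exact hf0 (eq_zero_of_pow_eq_zero heq)
    · intro i hi
      have h := hc i hi
      rw [Ideal.bot_pow (by have := (Finset.mem_Icc.1 hi).1; omega)] at h
      rw [(Ideal.mem_bot).1 h, zero_mul]
  obtain ⟨b, hb, hb0⟩ := Submodule.exists_mem_ne_zero_of_ne_bot hJ
  refine ⟨b ^ (r - 1), pow_ne_zero _ hb0, fun s => ?_⟩
  induction s using Nat.strong_induction_on with
  | _ s ih =>
  rcases lt_or_ge s r with hs | hs
  · exact Ideal.mul_mem_right _ _ (Ideal.pow_le_pow_right (by omega) (Ideal.pow_mem_pow hb _))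
  obtain ⟨t, rfl⟩ := exists_add_of_le hs
  have h : b ^ (r - 1) * f ^ (r + t) =
      -∑ i ∈ Finset.Icc 1 r, c i * (b ^ (r - 1) * f ^ (r + t - i)) := by
    rw [pow_add, eq_neg_of_add_eq_zero_left heq, neg_mul, mul_neg, Finset.sum_mul, Finset.mul_sum]
    congr 1
    refine Finset.sum_congr rfl fun i hi => ?_
    rw [Nat.sub_add_comm (Finset.mem_Icc.1 hi).2, pow_add]
    ring
  rw [h]
  refine neg_mem (Ideal.sum_mem _ fun i hi => ?_)
  obtain ⟨h1, h2⟩ := Finset.mem_Icc.1 hi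
  have := Ideal.mul_mem_mul (hc i hi) (ih (r + t - i) (by omega))
  rwa [← pow_add, Nat.add_sub_cancel' (by omega)] at this

theorem mul_sub_pow_mem {A : Type*} [CommRing A] {J : Ideal A} {c f g : A}
    (hf : ∀ s, c * f ^ s ∈ J ^ s) (hg : g ∈ J) (s : ℕ) : c * (f - g) ^ s ∈ J ^ s := by
  rw [sub_eq_add_neg, add_pow, Finset.mul_sum]
  refine Ideal.sum_mem _ fun i hi => ?_
  have := Ideal.mul_mem_mul (hf i) (Ideal.pow_mem_pow (neg_mem hg) (s - i))
  rw [← pow_add, Nat.add_sub_cancel' (by simpa [Nat.lt_succ_iff] using hi)] at this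
  simpa only [mul_assoc] using Ideal.mul_mem_right _ _ this

/-- A term belongs to an ideal if it does so locally at all primes of the coefficient ring. -/
theorem monomial_mem_of_forall_prime {σ R : Type*} [CommRing R] (hR : ¬ IsField R) [IsDomain R]
    [IsPrincipalIdealRing R] {J : Ideal (MvPolynomial σ R)} {m : σ →₀ ℕ} {a : R}
    (h : ∀ p, Prime p → ∀ u i, ¬ p ∣ u → a = u * p ^ i → (i, m) ∈ localExponents p J) :
    monomial m a ∈ J := by
  rcases eq_or_ne a 0 with rfl | ha
  · simp
  -- `K` is the ideal of multipliers taking the term into `J`. If proper, it lies in some `(p)`, yet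
  -- the local hypothesis at `p` gives an element of `K` outside `(p)`.
  let K : Ideal R :=
    { carrier := {b | monomial m (b * a) ∈ J}
      add_mem' := fun {b c} hb hc => by
        simp only [Set.mem_ofPred_eq] at *
        rw [add_mul, map_add]
        exact add_mem hb hc
      zero_mem' := by simp
      smul_mem' := fun c b hb => by
        simp only [Set.mem_ofPred_eq, smul_eq_mul] at *
        rw [mul_assoc, ← C_mul_monomial]
        exact J.mul_mem_left _ hb }
  by_contra hmem
  have hK : K ≠ ⊤ := fun hK => hmem <| by
    have : (1 : R) ∈ K := hK ▸ trivial
    simpa [K] using this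
  obtain ⟨P, hP, hKP⟩ := K.exists_le_maximal hK
  have hPbot : P ≠ ⊥ := Ring.ne_bot_of_isMaximal_of_not_isField hP hR
  obtain ⟨p, rfl⟩ := (IsPrincipalIdealRing.principal P).principal
  have hp : Prime p := by
    have hp0 : p ≠ 0 := by rintro rfl; simp at hPbot
    exact (Ideal.span_singleton_prime hp0).1 hP.isPrime
  obtain ⟨u, i, hu, rfl⟩ := exists_eq_mul_pow_of_ne_zero hp ha
  obtain ⟨v, hv, hvJ⟩ := h p hp u i hu rfl
  refine hv (Ideal.mem_span_singleton.1 (hKP ?_))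
  change monomial m (v * (u * p ^ i)) ∈ J
  have := J.mul_mem_left (C u) hvJ
  rw [C_mul_monomial] at this
  convert this using 2
  ring

theorem isIntegrallyClosedIdeal_pow_of_isClosedAt {σ R : Type*} [Finite σ] [LinearOrder σ]
    [CommRing R] (hR : ¬ IsField R) [IsDomain R] [IsPrincipalIdealRing R]
    {J : Ideal (MvPolynomial σ R)} (hJ : IsMultihomogeneous J) {e : ℕ}
    (h : ∀ (p : R) (hp : Prime p), (exponentFiltration hp hJ).IsClosedAt e) :
    IsIntegrallyClosedIdeal (J ^ e) := by
  classical
  intro f hf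
  rcases eq_or_ne f 0 with rfl | hf0
  · exact zero_mem _
  obtain ⟨c, hc, hcf⟩ := hf.exists_mul_pow_mem hf0
  -- Only `hcf` is kept: with the same `c`, it survives subtraction of elements of `J ^ e` by
  -- `mul_sub_pow_mem`.
  clear hf hf0
  induction hn : f.support.card using Nat.strong_induction_on generalizing f with
  | _ N ih =>
  rcases eq_or_ne f 0 with rfl | hf0
  · exact zero_mem _
  let o : MonomialOrder σ := MonomialOrder.lex
  have hlead : monomial (o.degree f) (o.leadingCoeff f) ∈ J ^ e := by
    refine monomial_mem_of_forall_prime hR fun p hp u i hu hui => ?_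
    have hc0 : o.leadingCoeff c ≠ 0 := o.leadingCoeff_ne_zero_iff.2 hc
    obtain ⟨v, j, hv, hvj⟩ := exists_eq_mul_pow_of_ne_zero hp hc0
    obtain ⟨r, hr, hmem⟩ := (exponentFiltration hp hJ).exists_nsmul_mem_of_forall_add_nsmul_mem
      (v := (j, o.degree c)) (w := (i, o.degree f)) (e := e) fun s => by
        refine ⟨v * u ^ s, fun hd => (hp.dvd_or_dvd hd).elim hv fun hd =>
          hu (hp.dvd_of_dvd_pow hd), ?_⟩
        rw [pow_mul]
        -- Leading terms multiply over a domain, so the leading term of `c * f ^ s` has local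
        -- exponent `v + s • w`.
        have := (hJ.pow e).pow s _ (hcf s) (o.degree (c * f ^ s))
        rw [← MonomialOrder.leadingCoeff, o.leadingCoeff_mul, o.leadingCoeff_pow,
          o.degree_mul hc (pow_ne_zero _ hf0), o.degree_pow, hvj, hui] at this
        convert this using 1
        refine congrArg (monomial _) ?_
        simp only [Prod.fst_add, Prod.smul_fst, smul_eq_mul]
        ring
    exact h p hp _ r hr hmem
  have hsub : f - monomial (o.degree f) (o.leadingCoeff f) ∈ J ^ e := by
    refine ih _ ?_ _ (mul_sub_pow_mem hcf hlead) rfl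
    rw [← hn]
    refine Finset.card_lt_card (Finset.ssubset_iff_of_subset (fun m hm => ?_) |>.2
      ⟨o.degree f, (o.degree_mem_support hf0), ?_⟩)
    · rw [mem_support_iff, coeff_sub, coeff_monomial] at hm
      rw [mem_support_iff]
      rintro h0
      split_ifs at hm with heq
      · subst heq
        exact hm (by simp [MonomialOrder.leadingCoeff])
      · exact hm (by simp [h0])
    · simp [MonomialOrder.leadingCoeff]
  simpa using add_mem hsub hlead

theorem isIntegrallyClosedIdeal_pow_of_forall_le_card {σ R : Type*} [Fintype σ] [LinearOrder σ]
    [CommRing R] (hR : ¬ IsField R) [IsDomain R] [IsPrincipalIdealRing R]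
    {J : Ideal (MvPolynomial σ R)} (hJ : IsMultihomogeneous J)
    (h : ∀ e, 1 ≤ e → e ≤ Fintype.card σ → IsIntegrallyClosedIdeal (J ^ e)) :
    IsNormalIdeal J := fun e he =>
  isIntegrallyClosedIdeal_pow_of_isClosedAt hR hJ fun _ hp =>
    ExponentFiltration.isClosedAt_of_forall_le_card _
      (fun e' h1 h2 => isClosedAt_exponentFiltration hp hJ (h e' h1 h2)) e he

end LocalExponents

/-! ### Passage to `k[x₀][x₁, …, x_n]`. -/

section Transport

theorem IsIntegralOverIdeal.map {A B : Type*} [CommRing A] [CommRing B] (φ : A →+* B) {I : Ideal A}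
    {a : A} (h : IsIntegralOverIdeal I a) : IsIntegralOverIdeal (I.map φ) (φ a) := by
  obtain ⟨r, hr, c, hc, heq⟩ := h
  refine ⟨r, hr, fun i => φ (c i), fun i hi => ?_, ?_⟩
  · rw [← Ideal.map_pow]
    exact Ideal.mem_map_of_mem φ (hc i hi)
  · simpa using congrArg φ heq

theorem IsIntegrallyClosedIdeal.map_equiv {A B : Type*} [CommRing A] [CommRing B] (φ : A ≃+* B)
    {I : Ideal A} (h : IsIntegrallyClosedIdeal I) :
    IsIntegrallyClosedIdeal (I.map (φ : A →+* B)) := by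
  intro b hb
  have h1 := hb.map (φ.symm : B →+* A)
  rw [Ideal.map_map] at h1
  have h2 : ((φ.symm : B →+* A).comp (φ : A →+* B)) = RingHom.id A := by ext; simp
  rw [h2, Ideal.map_id] at h1
  simpa using Ideal.mem_map_of_mem (φ : A →+* B) (h _ h1)

theorem isIntegrallyClosedIdeal_map_equiv_iff {A B : Type*} [CommRing A] [CommRing B] (φ : A ≃+* B)
    {I : Ideal A} :
    IsIntegrallyClosedIdeal (I.map (φ : A →+* B)) ↔ IsIntegrallyClosedIdeal I := by
  refine ⟨fun h => ?_, fun h => h.map_equiv φ⟩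
  have h1 := h.map_equiv φ.symm
  rw [Ideal.map_map] at h1
  have h2 : ((φ.symm : B →+* A).comp (φ : A →+* B)) = RingHom.id A := by ext; simp
  rwa [h2, Ideal.map_id] at h1

theorem exists_eq_of_mem_map_equiv {A B : Type*} [CommRing A] [CommRing B] (φ : A ≃+* B)
    {I : Ideal A} {b : B} (hb : b ∈ I.map (φ : A →+* B)) : ∃ a ∈ I, φ a = b :=
  (Ideal.mem_map_of_equiv φ b).1 hb

open MvPolynomial

/-- The isomorphism `k[x₀, …, x_n] ≃ k[x₀][x₁, …, x_n]`. -/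
noncomputable def splitFirstVariable (k : Type*) [CommRing k] (n : ℕ) :
    MvPolynomial (Fin (n + 1)) k ≃+* MvPolynomial (Fin n) (Polynomial k) :=
  ((renameEquiv k (_root_.finSuccEquiv n)).trans (optionEquivRight k (Fin n))).toRingEquiv

theorem splitFirstVariable_monomial {k : Type*} [CommRing k] {n : ℕ} (d : Fin (n + 1) →₀ ℕ)
    (b : k) :
    splitFirstVariable k n (monomial d b) =
      monomial (Finsupp.tail d) (Polynomial.monomial (d 0) b) := by
  rw [monomial_eq, monomial_eq, Finsupp.prod_fintype _ _ (by simp),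
    Finsupp.prod_fintype _ _ (by simp), Fin.prod_univ_succ, ← Polynomial.C_mul_X_pow_eq_monomial]
  simp [splitFirstVariable, mul_assoc, Finsupp.tail_apply]

/-- This turns homogeneity for the `ℤⁿ`-grading into `IsMultihomogeneous` over `k[x₀]`. -/
theorem splitFirstVariable_weightedHomogeneousComponent {k : Type*} [Field k] {n : ℕ}
    (m : Fin n →₀ ℕ) (f : MvPolynomial (Fin (n + 1)) k) :
    splitFirstVariable k n (weightedHomogeneousComponent (varDegree n) (fun i => (m i : ℤ)) f) =
      monomial m (coeff m (splitFirstVariable k n f)) := by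
  classical
  induction f using MvPolynomial.induction_on' with
  | monomial d b =>
    rw [splitFirstVariable_monomial, coeff_monomial,
      weightedHomogeneousComponent_of_mem (n := fun i => (d i.succ : ℤ))
        (isWeightedHomogeneous_monomial _ _ _ (weight_varDegree n d))]
    have hiff : ((fun i => (m i : ℤ)) = fun i => (d i.succ : ℤ)) ↔ Finsupp.tail d = m := by
      simp [funext_iff, Finsupp.ext_iff, Finsupp.tail_apply, eq_comm]
    by_cases h : Finsupp.tail d = m
    · rw [if_pos (hiff.2 h), if_pos h, splitFirstVariable_monomial, h]
    · rw [if_neg fun h' => h (hiff.1 h'), if_neg h, map_zero, map_zero]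
  | add f g hf hg => rw [map_add, map_add, map_add, coeff_add, map_add, hf, hg]

theorem isMultihomogeneous_map_splitFirstVariable {k : Type*} [Field k] {n : ℕ}
    {I : Ideal (MvPolynomial (Fin (n + 1)) k)} (hI : I.IsHomogeneous (gradedPiece k n)) :
    IsMultihomogeneous (I.map (splitFirstVariable k n :
      MvPolynomial (Fin (n + 1)) k →+* MvPolynomial (Fin n) (Polynomial k))) := by
  intro g hg m
  obtain ⟨f, hf, rfl⟩ := exists_eq_of_mem_map_equiv _ hg
  rw [← splitFirstVariable_weightedHomogeneousComponent]
  exact Ideal.mem_map_of_mem _ (weightedHomogeneousComponent_mem_of_mem k (varDegree n) hI hf _)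

end Transport

/-- Let `k` be an algebraically closed field of characteristic zero and `n ≥ 1`. An ideal `I` of
`k[x₀, …, x_n]` that is homogeneous for the `ℤⁿ`-grading with pieces `k[x₀] x₁ ^ m₁ ⋯ x_n ^ m_n` is
normal if and only if `I ^ e` is integrally closed for all `e ∈ {1, …, n}`. -/
theorem mainTheorem6 {k : Type*} [Field k] [IsAlgClosed k] [CharZero k] (n : ℕ) (hn : 1 ≤ n)
    (I : Ideal (MvPolynomial (Fin (n + 1)) k)) (hI : I.IsHomogeneous (gradedPiece k n)) :
    IsNormalIdeal I ↔ ∀ e ∈ Finset.Icc 1 n, IsIntegrallyClosedIdeal (I ^ e) := by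
  refine ⟨fun h e he => h e (Finset.mem_Icc.1 he).1, fun h e he => ?_⟩
  rw [← isIntegrallyClosedIdeal_map_equiv_iff (splitFirstVariable k n), Ideal.map_pow]
  refine isIntegrallyClosedIdeal_pow_of_forall_le_card (Polynomial.not_isField k)
    (isMultihomogeneous_map_splitFirstVariable hI) (fun e' h1 h2 => ?_) e he
  rw [← Ideal.map_pow, isIntegrallyClosedIdeal_map_equiv_iff]
  exact h e' (Finset.mem_Icc.2 ⟨h1, by simpa using h2⟩)
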